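/- For a positive integer $N$ write $\mathbb{Z}_N=\mathbb{Z}/N\mathbb{Z}$, let $\mathbb{E}$ denote the average over $\mathbb{Z}_N$ in each variable, and write $A(x)$ for the characteristic function of a set $A\subseteq\mathbb{Z}_N$. Put $\hat A(r)=\mathbb{E}_{x}A(x)e^{-2\pi i rx/N}$, and call $A$ $\gamma$-uniform if $|\hat A(r)|\le\gamma$ for every $r\ne 0$. The density of $A$ is $|A|/N$. Theorem. (i) There exist absolute constants $c>0$ and $C$ such that for every sufficiently large $N$ there is a $CN^{-1/2}\log N$-uniform set $A\subseteq\mathbb{Z}_N$ of density $\frac12+o(1)$ (where $o(1)$ tends to $0$ as $N\to\infty$) for which $$\mathbb{E}_{x,d}A(x)A(x+d)A(x+2d)A(x+3d)\le \tfrac1{16}-c.$$ (ii) Consequently the following conjecture is false: there is a function $\gamma\mapsto\eta(\gamma)$ with $\eta(\gamma)\to0$ as $\gamma\to0^+$ such that, for every $\gamma>0$ and every $N$ sufficiently large in terms of $\gamma$, each $\gamma$-uniform set $A\subseteq\mathbb{Z}_N$ of density $\delta$ contains at least $(\delta^4-\eta(\gamma))N^2$ quadruples of the form $(x,x+d,x+2d,x+3d)$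 with $x,d\in\mathbb{Z}_N$. -/

import Mathlib

open Filter Topology
open scoped BigOperators

noncomputable section

namespace UniformSet

/-- The characteristic function of `A`, written `A(x)`, with values in a ring `R`. -/
def char {N : ℕ} (R : Type) [Zero R] [One R] (A : Finset (ZMod N)) (x : ZMod N) : R :=
  if x ∈ A then 1 else 0

/-- The Fourier coefficient `E_x f(x) ω^{-rx}`, where `ω = exp (2πi/N)`
(`ZMod.stdAddChar` is the character `j ↦ ω^j`). -/
def fourier {N : ℕ} [NeZero N] (f : ZMod N → ℂ) (r : ZMod N) : ℂ :=
  𝔼 x : ZMod N, f x * ZMod.stdAddChar (-(r * x))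

/-- `A` is `c`-uniform: every Fourier coefficient `Â(r)` with `r ≠ 0` has modulus at most `c`. -/
def IsUniform {N : ℕ} [NeZero N] (c : ℝ) (A : Finset (ZMod N)) : Prop :=
  ∀ r : ZMod N, r ≠ 0 → ‖fourier (char ℂ A) r‖ ≤ c

/-- The density `|A| / N`. -/
def density {N : ℕ} (A : Finset (ZMod N)) : ℝ :=
  (A.card : ℝ) / N

/-- The average `E_{x,d} A(x) A(x+d) A(x+2d) A(x+3d)`. -/
def fourAPDensity {N : ℕ} [NeZero N] (A : Finset (ZMod N)) : ℝ :=
  𝔼 x : ZMod N, 𝔼 d : ZMod N,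
    char ℝ A x * char ℝ A (x + d) * char ℝ A (x + 2 * d) * char ℝ A (x + 3 * d)

/-- The number of quadruples `(x, x+d, x+2d, x+3d)` in `A⁴`; such a quadruple is determined by,
and determines, the pair `(x, d)`. -/
def fourAPCount {N : ℕ} [NeZero N] (A : Finset (ZMod N)) : ℕ :=
  (Finset.univ.filter fun p : ZMod N × ZMod N =>
    p.1 ∈ A ∧ p.1 + p.2 ∈ A ∧ p.1 + 2 * p.2 ∈ A ∧ p.1 + 3 * p.2 ∈ A).card

/-- The conjecture: there is a function `c' = η c` tending to zero as `c` tends to zero such that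
(for `N` sufficiently large in terms of `c`) a `c`-uniform set of density `δ` contains at least
`(δ⁴ - c') N²` quadruples `(x, x+d, x+2d, x+3d)`. -/
def FourAPConjecture : Prop :=
  ∃ η : ℝ → ℝ, Tendsto η (𝓝[>] 0) (𝓝 0) ∧
    ∀ c : ℝ, 0 < c → ∃ N₀ : ℕ, ∀ (N : ℕ) [NeZero N], N₀ ≤ N →
      ∀ A : Finset (ZMod N), IsUniform c A →
        (density A ^ 4 - η c) * (N : ℝ) ^ 2 ≤ (fourAPCount A : ℝ)

end UniformSet

end

namespace UniformSet

variable {N : ℕ} [NeZero N]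

/-! Small Fourier coefficients do not exclude quadratic structure, and the identity x² - 3(x+d)² +
3(x+2d)² - (x+3d)² = 0 lets quadratic phases bias the count of progressions. `profile` is 1/2 plus
cosines with quadratic coefficients ±1 and ±3, so Gauss sum estimates (`norm_expect_quadratic_le`)
make its nontrivial Fourier coefficients O(N^(-1/2)). Expanding `progressionAvg` of it, a quadruple
of phases contributes its weight if the phases cancel identically and O(N^(-1/2)) otherwise
(`norm_phaseCorrelation_sub_le`). For a real function built from pure squares with coefficients a_m,
the nonconstant cancelling quadruples would contribute 2|a_1|²|a_3|² ≥ 0; the linear terms are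
chosen so that only negative products survive, giving 1/16 - 1/16384 (`sum_weight_phasesCancel`).

A random set containing each x independently with probability `profile x` inherits these properties
up to O(N^(-1/2) log N) in the Fourier coefficients and O(1/N) in the progressions
(`exists_finset_approx`). The fixed deficit below 1/16 then contradicts the conjecture. -/

/-! ### Linear congruences and Gauss sums -/

theorem card_intCast_mul_eq_zero_le {k : ℤ} (hk : k ≠ 0) :
    (Finset.univ.filter fun h : ZMod N => (k : ZMod N) * h = 0).card ≤ k.natAbs := by
  have h := IsAddCyclic.card_nsmul_eq_zero_le (α := ZMod N) (Int.natAbs_pos.mpr hk)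
  refine le_trans (Finset.card_le_card ?_) h
  intro x hx
  simp only [Finset.mem_filter, Finset.mem_univ, true_and] at hx ⊢
  rw [nsmul_eq_mul]
  rcases Int.natAbs_eq k with h' | h'
  · rw [h'] at hx; simpa using hx
  · rw [h'] at hx; simpa using hx

theorem card_intCast_mul_add_eq_zero_le {k : ℤ} (hk : k ≠ 0) (b : ZMod N) :
    (Finset.univ.filter fun h : ZMod N => (k : ZMod N) * h + b = 0).card ≤ k.natAbs := by
  rcases (Finset.univ.filter fun h : ZMod N => (k : ZMod N) * h + b = 0).eq_empty_or_nonempty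
    with h0 | ⟨y, hy⟩
  · simp [h0]
  · refine le_trans (Finset.card_le_card_of_injOn (fun x => x - y) ?_ ?_)
      (card_intCast_mul_eq_zero_le (N := N) hk)
    · intro x hx
      simp only [Finset.coe_filter, Finset.mem_filter, Finset.mem_univ, true_and,
        Set.mem_ofPred_eq] at hx hy ⊢
      linear_combination hx - hy
    · intro x _ x' _ h
      simpa using h

theorem sum_stdAddChar_mul (b : ZMod N) :
    ∑ x : ZMod N, ZMod.stdAddChar (b * x) = if b = 0 then (N : ℂ) else 0 := by
  have h := AddChar.sum_mulShift b (ZMod.isPrimitive_stdAddChar N)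
  simpa [mul_comm, ZMod.card] using h

theorem norm_stdAddChar (x : ZMod N) : ‖(ZMod.stdAddChar x : ℂ)‖ = 1 :=
  AddChar.norm_apply _ _

/-- Squaring and substituting x = y + h leaves a phase linear in y, whose sum vanishes unless 2ah =
0. -/
theorem norm_sum_quadratic_sq_le (a b : ZMod N) :
    ‖∑ x : ZMod N, (ZMod.stdAddChar (a * x ^ 2 + b * x) : ℂ)‖ ^ 2 ≤
      N * (Finset.univ.filter fun h : ZMod N => 2 * a * h = 0).card := by
  set S := ∑ x : ZMod N, (ZMod.stdAddChar (a * x ^ 2 + b * x) : ℂ)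
  have key : S * (starRingEnd ℂ) S =
      ∑ h : ZMod N, ZMod.stdAddChar (a * h ^ 2 + b * h) *
        if 2 * a * h = 0 then (N : ℂ) else 0 := by
    calc S * (starRingEnd ℂ) S
        = ∑ y : ZMod N, ∑ x : ZMod N,
            (ZMod.stdAddChar (a * x ^ 2 + b * x - (a * y ^ 2 + b * y)) : ℂ) := by
          rw [map_sum, Finset.sum_mul_sum, Finset.sum_comm]
          refine Finset.sum_congr rfl fun y _ => Finset.sum_congr rfl fun x _ => ?_
          rw [← AddChar.map_neg_eq_conj, ← AddChar.map_add_eq_mul, sub_eq_add_neg]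
      _ = ∑ y : ZMod N, ∑ h : ZMod N,
            (ZMod.stdAddChar (a * h ^ 2 + b * h) * ZMod.stdAddChar (2 * a * h * y) : ℂ) := by
          refine Finset.sum_congr rfl fun y _ => ?_
          rw [← Equiv.sum_comp (Equiv.addRight y)]
          refine Finset.sum_congr rfl fun h _ => ?_
          rw [← AddChar.map_add_eq_mul, Equiv.coe_addRight]
          congr 1
          ring
      _ = _ := by
          rw [Finset.sum_comm]
          refine Finset.sum_congr rfl fun h _ => ?_
          rw [← Finset.mul_sum, sum_stdAddChar_mul]
  have hn : ‖S‖ ^ 2 = ‖S * (starRingEnd ℂ) S‖ := by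
    rw [norm_mul, RCLike.norm_conj, sq]
  rw [hn, key]
  refine (norm_sum_le _ _).trans ?_
  rw [Finset.card_filter, Nat.cast_sum, Finset.mul_sum]
  refine Finset.sum_le_sum fun h _ => ?_
  rw [norm_mul, norm_stdAddChar]
  split_ifs <;> simp

theorem norm_expect_quadratic_le {k : ℤ} (hk : k ≠ 0) (b : ZMod N) :
    ‖𝔼 x : ZMod N, (ZMod.stdAddChar ((k : ZMod N) * x ^ 2 + b * x) : ℂ)‖ ≤
      √(2 * |(k : ℝ)| / N) := by
  have hN : (0 : ℝ) < N := by exact_mod_cast Nat.pos_of_neZero N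
  rw [Fintype.expect_eq_sum_div_card, norm_div, ZMod.card]
  apply Real.le_sqrt_of_sq_le
  rw [div_pow, Complex.norm_natCast, div_le_div_iff₀ (by positivity) hN]
  have h1 := norm_sum_quadratic_sq_le (k : ZMod N) b
  have h2 := card_intCast_mul_eq_zero_le (N := N) (k := 2 * k) (by omega)
  have h3 : (((2 * k).natAbs : ℕ) : ℝ) = 2 * |(k : ℝ)| := by
    rw [Nat.cast_natAbs]; push_cast; rw [abs_mul]; simp
  have h4 : ((Finset.univ.filter fun h : ZMod N => 2 * (k : ZMod N) * h = 0).card : ℝ)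
      ≤ 2 * |(k : ℝ)| := by
    rw [← h3]; exact_mod_cast h2
  nlinarith [mul_le_mul_of_nonneg_left h4 hN.le]

theorem norm_expect_le_of_forall {ι : Type*} [Fintype ι] [Nonempty ι] {f : ι → ℂ} {c : ℝ}
    (h : ∀ i, ‖f i‖ ≤ c) : ‖𝔼 i, f i‖ ≤ c :=
  (RCLike.norm_expect_le (K := ℂ)).trans (Finset.expect_le Finset.univ_nonempty fun i _ => h i)

theorem intCast_ne_zero_of_abs_lt {N : ℕ} {k : ℤ} (hk : k ≠ 0) (h : |k| < N) : (k : ZMod N) ≠ 0 := by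
  rw [Ne, ZMod.intCast_zmod_eq_zero_iff_dvd]
  intro hd
  exact hk (Int.eq_zero_of_abs_lt_dvd hd h)

/-! ### Averages of two-variable quadratic phases -/

/-- The average of `e((A x² + B x d + C d² + D x + E d)/N)` over `x, d ∈ ℤ/N`. -/
noncomputable def phaseAvg (N : ℕ) [NeZero N] (A B C D E : ℤ) : ℂ :=
  𝔼 x : ZMod N, 𝔼 d : ZMod N, (ZMod.stdAddChar
    ((A : ZMod N) * x ^ 2 + (B : ZMod N) * x * d + (C : ZMod N) * d ^ 2 +
      (D : ZMod N) * x + (E : ZMod N) * d) : ℂ)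

theorem phaseAvg_swap (A B C D E : ℤ) : phaseAvg N A B C D E = phaseAvg N C B A E D := by
  unfold phaseAvg
  rw [Finset.expect_comm]
  refine Finset.expect_congr rfl fun x _ => Finset.expect_congr rfl fun y _ => ?_
  congr 1; ring

theorem norm_phaseAvg_le_of_sq {A B C D E : ℤ} (hC : C ≠ 0) :
    ‖phaseAvg N A B C D E‖ ≤ √(2 * |(C : ℝ)| / N) := by
  refine norm_expect_le_of_forall fun x => ?_
  have : ∀ d : ZMod N, (ZMod.stdAddChar
      ((A : ZMod N) * x ^ 2 + (B : ZMod N) * x * d + (C : ZMod N) * d ^ 2 +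
      (D : ZMod N) * x + (E : ZMod N) * d) : ℂ) =
      ZMod.stdAddChar ((A : ZMod N) * x ^ 2 + (D : ZMod N) * x) *
        ZMod.stdAddChar ((C : ZMod N) * d ^ 2 + ((B : ZMod N) * x + (E : ZMod N)) * d) := by
    intro d
    rw [← AddChar.map_add_eq_mul]; congr 1; ring
  simp_rw [this, ← Finset.mul_expect, norm_mul, norm_stdAddChar, one_mul]
  exact norm_expect_quadratic_le hC _

/-- For fixed x the phase is linear in d, so only the zeros of B x + E contribute. -/
theorem norm_phaseAvg_bilinear_le (B D E : ℤ) :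
    ‖phaseAvg N 0 B 0 D E‖ ≤
      ((Finset.univ.filter fun x : ZMod N => (B : ZMod N) * x + E = 0).card : ℝ) / N := by
  unfold phaseAvg
  refine (RCLike.norm_expect_le (K := ℂ)).trans ?_
  rw [Fintype.expect_eq_sum_div_card, ZMod.card, Finset.card_filter, Nat.cast_sum]
  gcongr with x _
  have : ∀ d : ZMod N, (ZMod.stdAddChar
      (((0 : ℤ) : ZMod N) * x ^ 2 + (B : ZMod N) * x * d + ((0 : ℤ) : ZMod N) * d ^ 2 +
        (D : ZMod N) * x + (E : ZMod N) * d) : ℂ) =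
      ZMod.stdAddChar ((D : ZMod N) * x) *
        ZMod.stdAddChar (((B : ZMod N) * x + (E : ZMod N)) * d) := by
    intro d
    rw [← AddChar.map_add_eq_mul]; congr 1; push_cast; ring
  simp_rw [this, ← Finset.mul_expect, norm_mul, norm_stdAddChar, one_mul]
  rw [Fintype.expect_eq_sum_div_card, sum_stdAddChar_mul, ZMod.card]
  have hN : (N : ℂ) ≠ 0 := by exact_mod_cast NeZero.ne N
  split_ifs <;> simp [hN]

/-- A polynomial phase in two variables with bounded integer coefficients has small average,
unless the polynomial vanishes identically. -/
theorem norm_phaseAvg_le {A B C D E K : ℤ} (hA : |A| ≤ K) (hB : |B| ≤ K) (hC : |C| ≤ K)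
    (hD : |D| ≤ K) (hE : |E| ≤ K) (hK : K < N)
    (h : ¬ (A = 0 ∧ B = 0 ∧ C = 0 ∧ D = 0 ∧ E = 0)) :
    ‖phaseAvg N A B C D E‖ ≤ √(2 * K / N) := by
  have hN : (0 : ℝ) < N := by exact_mod_cast Nat.pos_of_neZero N
  have cast_le : ∀ {k : ℤ}, |k| ≤ K → |(k : ℝ)| ≤ K := fun hk => by exact_mod_cast hk
  by_cases hC0 : C = 0
  swap
  · refine (norm_phaseAvg_le_of_sq hC0).trans (Real.sqrt_le_sqrt ?_)
    gcongr; exact cast_le hC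
  by_cases hA0 : A = 0
  swap
  · rw [phaseAvg_swap]
    refine (norm_phaseAvg_le_of_sq hA0).trans (Real.sqrt_le_sqrt ?_)
    gcongr; exact cast_le hA
  subst hC0 hA0
  by_cases hB0 : B = 0
  swap
  · refine (norm_phaseAvg_bilinear_le B D E).trans ?_
    have h1 := card_intCast_mul_add_eq_zero_le (N := N) hB0 (E : ZMod N)
    have h2 : ((Finset.univ.filter fun x : ZMod N => (B : ZMod N) * x + E = 0).card : ℝ) ≤ K := by
      refine le_trans (Nat.cast_le.mpr h1) ?_
      rw [Nat.cast_natAbs]; exact_mod_cast hB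
    have hK0 : (0 : ℝ) ≤ K := le_trans (by positivity) h2
    -- Since K/N ≤ 1, the bound K/N obtained here is weaker than no square root: (K/N)² ≤ 2K/N.
    have hKN : (K : ℝ) / N ≤ 1 := by
      rw [div_le_one hN]; exact_mod_cast hK.le
    have h0 : (0 : ℝ) ≤ K / N := by positivity
    refine (div_le_div_of_nonneg_right h2 hN.le).trans (Real.le_sqrt_of_sq_le ?_)
    rw [mul_div_assoc]
    nlinarith
  subst hB0
  by_cases hE0 : E = 0
  swap
  · refine (norm_phaseAvg_bilinear_le 0 D E).trans (le_trans (le_of_eq ?_) (Real.sqrt_nonneg _))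
    simp [intCast_ne_zero_of_abs_lt hE0 (hE.trans_lt hK)]
  subst hE0
  have hD0 : D ≠ 0 := by simpa using h
  rw [phaseAvg_swap]
  refine (norm_phaseAvg_bilinear_le 0 0 D).trans (le_trans (le_of_eq ?_) (Real.sqrt_nonneg _))
  simp [intCast_ne_zero_of_abs_lt hD0 (hD.trans_lt hK)]

/-- The average of `f(x) f(x+d) f(x+2d) f(x+3d)`. -/
noncomputable def progressionAvg {R : Type*} [Semifield R] [CharZero R] (f : ZMod N → R) : R :=
  𝔼 x : ZMod N, 𝔼 d : ZMod N, f x * f (x + d) * f (x + 2 * d) * f (x + 3 * d)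

/-! ### Independent random sets -/

section RandomSet

variable {ι : Type*} [Fintype ι] [DecidableEq ι]

/-- The probability of `A` when each `x` is put into `A` independently with probability `F x`. -/
noncomputable def setWeight (F : ι → ℝ) (A : Finset ι) : ℝ :=
  ∏ x, if x ∈ A then F x else 1 - F x

theorem setWeight_nonneg {F : ι → ℝ} (h0 : ∀ x, 0 ≤ F x) (h1 : ∀ x, F x ≤ 1) (A : Finset ι) :
    0 ≤ setWeight F A := by
  refine Finset.prod_nonneg fun x _ => ?_
  split_ifs
  · exact h0 x
  · linarith [h1 x]

/-- Expanding the right-hand product selects one summand at each x; A is the set where the first is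
selected. -/
theorem sum_setWeight_mul_prod (F u v : ι → ℝ) :
    ∑ A : Finset ι, setWeight F A * ∏ x, (if x ∈ A then u x else v x) =
      ∏ x, (F x * u x + (1 - F x) * v x) := by
  rw [Finset.prod_add, Finset.powerset_univ]
  refine Finset.sum_congr rfl fun A _ => ?_
  rw [setWeight, ← Finset.prod_mul_distrib, ← Finset.prod_mul_prod_compl A]
  rw [← Finset.compl_eq_univ_sdiff]
  congr 1
  · refine Finset.prod_congr rfl fun x hx => ?_
    simp [hx]
  · refine Finset.prod_congr rfl fun x hx => ?_
    rw [Finset.mem_compl] at hx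
    simp [hx]

theorem sum_setWeight (F : ι → ℝ) : ∑ A : Finset ι, setWeight F A = 1 := by
  simpa using sum_setWeight_mul_prod F (fun _ => 1) (fun _ => 1)

theorem sum_setWeight_mul_subset (F : ι → ℝ) (S : Finset ι) :
    ∑ A : Finset ι, setWeight F A * (if S ⊆ A then 1 else 0) = ∏ x ∈ S, F x := by
  have h := sum_setWeight_mul_prod F (fun _ => 1) (fun x => if x ∈ S then 0 else 1)
  have h2 : ∏ x, (F x * 1 + (1 - F x) * if x ∈ S then 0 else 1) = ∏ x ∈ S, F x := by
    rw [← Finset.prod_mul_prod_compl S]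
    rw [Finset.prod_congr rfl (g := F) fun x hx => by simp [hx],
      Finset.prod_eq_one (s := Sᶜ) fun x hx => ?_, mul_one]
    rw [Finset.mem_compl] at hx
    simp [hx]
  rw [h2] at h
  rw [← h]
  refine Finset.sum_congr rfl fun A _ => ?_
  congr 1
  split_ifs with hSA
  · symm
    refine Finset.prod_eq_one fun x _ => ?_
    by_cases hx : x ∈ S
    · simp [hSA hx]
    · simp [hx]
  · obtain ⟨x, hxS, hxA⟩ := Finset.not_subset.mp hSA
    exact (Finset.prod_eq_zero (Finset.mem_univ x) (by simp [hxS, hxA])).symm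

/-- Apply e^s ≤ 1 + s + s² to both exponentials: the linear terms cancel because the variable is
centred, and 1 + t² ≤ exp(t²). -/
theorem bernoulli_exp_le {p t : ℝ} (h0 : 0 ≤ p) (h1 : p ≤ 1) (ht : |t| ≤ 1) :
    p * Real.exp ((1 - p) * t) + (1 - p) * Real.exp (-p * t) ≤ Real.exp (t ^ 2) := by
  have hb : ∀ q : ℝ, |q| ≤ 1 → Real.exp (q * t) ≤ 1 + q * t + t ^ 2 := by
    intro q hq
    have hqt : |q * t| ≤ 1 := by
      rw [abs_mul]; exact mul_le_one₀ hq (abs_nonneg _) ht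
    have h := (abs_le.mp (Real.abs_exp_sub_one_sub_id_le hqt)).2
    have hq2 : q ^ 2 ≤ 1 := (sq_le_one_iff_abs_le_one q).mpr hq
    nlinarith [mul_le_mul_of_nonneg_right hq2 (sq_nonneg t)]
  have e1 := hb (1 - p) (by rw [abs_le]; constructor <;> linarith)
  have e2 := hb (-p) (by rw [abs_le]; constructor <;> linarith)
  have e3 := Real.add_one_le_exp (t ^ 2)
  nlinarith [mul_le_mul_of_nonneg_left e1 h0,
    mul_le_mul_of_nonneg_left e2 (sub_nonneg.mpr h1)]

theorem sum_setWeight_mul_exp_le {F : ι → ℝ} (h0 : ∀ x, 0 ≤ F x) (h1 : ∀ x, F x ≤ 1)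
    {t : ι → ℝ} (ht : ∀ x, |t x| ≤ 1) :
    ∑ A : Finset ι, setWeight F A * Real.exp (∑ x, ((if x ∈ A then 1 else 0) - F x) * t x) ≤
      Real.exp (∑ x, t x ^ 2) := by
  have h := sum_setWeight_mul_prod F (fun x => Real.exp ((1 - F x) * t x))
    (fun x => Real.exp (-F x * t x))
  calc _ = ∏ x, (F x * Real.exp ((1 - F x) * t x) + (1 - F x) * Real.exp (-F x * t x)) := by
        rw [← h]
        refine Finset.sum_congr rfl fun A _ => ?_
        rw [Real.exp_sum]
        congr 1
        refine Finset.prod_congr rfl fun x _ => ?_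
        split_ifs <;> simp
    _ ≤ ∏ x, Real.exp (t x ^ 2) := by
        refine Finset.prod_le_prod (fun x _ => ?_) fun x _ => bernoulli_exp_le (h0 x) (h1 x) (ht x)
        have := h0 x
        have := sub_nonneg.mpr (h1 x)
        positivity
    _ = _ := (Real.exp_sum _ _).symm

theorem exists_le_of_sum_setWeight_mul_le {F : ι → ℝ} (h0 : ∀ x, 0 ≤ F x) (h1 : ∀ x, F x ≤ 1)
    {Φ : Finset ι → ℝ} {m : ℝ} (h : ∑ A, setWeight F A * Φ A ≤ m) : ∃ A, Φ A ≤ m := by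
  by_contra! hc
  have hs := sum_setWeight F
  have hge : ∀ A, 0 ≤ setWeight F A * (Φ A - m) := fun A =>
    mul_nonneg (setWeight_nonneg h0 h1 A) (sub_nonneg.mpr (hc A).le)
  have hsum : ∑ A, setWeight F A * (Φ A - m) ≤ 0 := by
    simp_rw [mul_sub, Finset.sum_sub_distrib, ← Finset.sum_mul, hs]
    linarith
  have hz := (Finset.sum_eq_zero_iff_of_nonneg fun A _ => hge A).mp
    (le_antisymm hsum (Finset.sum_nonneg fun A _ => hge A))
  have : ∀ A, setWeight F A = 0 := fun A =>
    (mul_eq_zero.mp (hz A (Finset.mem_univ A))).resolve_right (sub_pos.mpr (hc A)).ne'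
  simp [this] at hs

end RandomSet

/-! ### From functions to sets -/

theorem char_mul_eq_ite_subset {N : ℕ} (A : Finset (ZMod N)) (a b c d : ZMod N) :
    char ℝ A a * char ℝ A b * char ℝ A c * char ℝ A d =
      if ({a, b, c, d} : Finset (ZMod N)) ⊆ A then 1 else 0 := by
  simp only [char, Finset.insert_subset_iff, Finset.singleton_subset_iff]
  by_cases ha : a ∈ A <;> by_cases hb : b ∈ A <;> by_cases hc : c ∈ A <;>
    by_cases hd : d ∈ A <;> simp [ha, hb, hc, hd]

/-- If 6d ≠ 0 then d, 2d, 3d are nonzero, so the four points are distinct and independence gives the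
product; otherwise the trivial bound 1 is used. -/
theorem sum_setWeight_mul_progression_le {F : ZMod N → ℝ} (h0 : ∀ x, 0 ≤ F x)
    (h1 : ∀ x, F x ≤ 1) (x d : ZMod N) :
    ∑ A : Finset (ZMod N), setWeight F A *
        (char ℝ A x * char ℝ A (x + d) * char ℝ A (x + 2 * d) * char ℝ A (x + 3 * d)) ≤
      F x * F (x + d) * F (x + 2 * d) * F (x + 3 * d) + if 6 * d = 0 then 1 else 0 := by
  simp_rw [char_mul_eq_ite_subset]
  have hp : 0 ≤ F x * F (x + d) * F (x + 2 * d) * F (x + 3 * d) :=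
    mul_nonneg (mul_nonneg (mul_nonneg (h0 _) (h0 _)) (h0 _)) (h0 _)
  rw [sum_setWeight_mul_subset]
  split_ifs with hd
  · have := Finset.prod_le_one (s := ({x, x + d, x + 2 * d, x + 3 * d} : Finset (ZMod N)))
      (fun y _ => h0 y) (fun y _ => h1 y)
    linarith
  · have d1 : d ≠ 0 := fun h => hd (by rw [h, mul_zero])
    have d2 : 2 * d ≠ 0 := fun h => hd (by linear_combination 3 * h)
    have d3 : 3 * d ≠ 0 := fun h => hd (by linear_combination 2 * h)
    rw [Finset.prod_insert, Finset.prod_insert, Finset.prod_insert, Finset.prod_singleton]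
    · rw [add_zero, mul_assoc, mul_assoc]
    · rw [Finset.mem_singleton]
      exact fun h => d1 (by linear_combination -h)
    · simp only [Finset.mem_insert, Finset.mem_singleton, not_or]
      exact ⟨fun h => d1 (by linear_combination -h), fun h => d2 (by linear_combination -h)⟩
    · simp only [Finset.mem_insert, Finset.mem_singleton, not_or]
      exact ⟨fun h => d1 (by linear_combination -h), fun h => d2 (by linear_combination -h),
        fun h => d3 (by linear_combination -h)⟩

theorem sum_setWeight_mul_fourAPDensity_le {F : ZMod N → ℝ} (h0 : ∀ x, 0 ≤ F x)
    (h1 : ∀ x, F x ≤ 1) :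
    ∑ A : Finset (ZMod N), setWeight F A * fourAPDensity A ≤ progressionAvg F + 6 / N := by
  have hswap : ∑ A : Finset (ZMod N), setWeight F A * fourAPDensity A =
      𝔼 x : ZMod N, 𝔼 d : ZMod N, ∑ A : Finset (ZMod N), setWeight F A *
        (char ℝ A x * char ℝ A (x + d) * char ℝ A (x + 2 * d) * char ℝ A (x + 3 * d)) := by
    simp_rw [fourAPDensity, Finset.mul_expect, Finset.expect_sum_comm]
  have hbad : 𝔼 d : ZMod N, (if 6 * d = 0 then (1 : ℝ) else 0) ≤ 6 / N := by
    rw [Fintype.expect_eq_sum_div_card, ZMod.card]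
    gcongr
    rw [Finset.sum_boole]
    have := card_intCast_mul_eq_zero_le (N := N) (k := 6) (by norm_num)
    exact_mod_cast this
  rw [hswap]
  refine (Finset.expect_le_expect fun x _ => Finset.expect_le_expect fun d _ =>
    sum_setWeight_mul_progression_le h0 h1 x d).trans ?_
  simp_rw [Finset.expect_add_distrib]
  rw [Fintype.expect_const]
  exact add_le_add_right hbad _

theorem re_mul_fourier_sub (F : ZMod N → ℝ) (A : Finset (ZMod N)) (r : ZMod N) (z : ℂ) :
    N * (z * (fourier (char ℂ A) r - fourier (fun x => (F x : ℂ)) r)).re =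
      ∑ x, ((if x ∈ A then 1 else 0) - F x) * (z * ZMod.stdAddChar (-(r * x))).re := by
  have hN : (N : ℂ) ≠ 0 := by exact_mod_cast NeZero.ne N
  have h : (N : ℂ) * (z * (fourier (char ℂ A) r - fourier (fun x => (F x : ℂ)) r)) =
      ∑ x, (((if x ∈ A then 1 else 0) - F x : ℝ) : ℂ) * (z * ZMod.stdAddChar (-(r * x))) := by
    rw [fourier, fourier, ← Finset.expect_sub_distrib, Fintype.expect_eq_sum_div_card, ZMod.card,
      mul_left_comm, mul_div_cancel₀ _ hN, Finset.mul_sum]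
    refine Finset.sum_congr rfl fun x _ => ?_
    rw [char]
    split_ifs <;> push_cast <;> ring
  have h2 := congrArg Complex.re h
  rw [← Complex.ofReal_natCast, Complex.re_ofReal_mul, Complex.re_sum] at h2
  simpa only [Complex.re_ofReal_mul] using h2

/-- After scaling by √N each point carries a coefficient of size at most N^(-1/2); the squares sum
to at most 1, so the moment is at most e < 3. -/
theorem sum_setWeight_mul_exp_fourier_le {F : ZMod N → ℝ} (h0 : ∀ x, 0 ≤ F x)
    (h1 : ∀ x, F x ≤ 1) (r : ZMod N) {z : ℂ} (hz : ‖z‖ = 1) :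
    ∑ A : Finset (ZMod N), setWeight F A *
      Real.exp (√N * (z * (fourier (char ℂ A) r - fourier (fun x => (F x : ℂ)) r)).re) ≤ 3 := by
  have hN : (1 : ℝ) ≤ N := by exact_mod_cast NeZero.one_le
  have hs : (1 : ℝ) ≤ √N := Real.one_le_sqrt.mpr hN
  have hss : √N * √N = (N : ℝ) := Real.mul_self_sqrt (by linarith)
  set t : ZMod N → ℝ := fun x => (√N)⁻¹ * (z * ZMod.stdAddChar (-(r * x))).re with ht
  have hre : ∀ x, |(z * (ZMod.stdAddChar (-(r * x)) : ℂ)).re| ≤ 1 := fun x =>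
    (Complex.abs_re_le_norm _).trans (by rw [norm_mul, hz, norm_stdAddChar, one_mul])
  have ht2 : ∀ x, t x ^ 2 ≤ (N : ℝ)⁻¹ := fun x => by
    rw [ht]
    simp only [mul_pow, inv_pow]
    rw [Real.sq_sqrt (by linarith)]
    exact mul_le_of_le_one_right (by positivity) ((sq_le_one_iff_abs_le_one _).mpr (hre x))
  have ht1 : ∀ x, |t x| ≤ 1 := fun x =>
    (sq_le_one_iff_abs_le_one _).mp ((ht2 x).trans (inv_le_one_of_one_le₀ hN))
  have h := sum_setWeight_mul_exp_le h0 h1 ht1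
  have hsum : ∑ x, t x ^ 2 ≤ 1 := by
    refine (Finset.sum_le_sum fun x _ => ht2 x).trans (le_of_eq ?_)
    rw [Finset.sum_const, Finset.card_univ, ZMod.card, nsmul_eq_mul]
    field_simp
  refine le_trans (le_of_eq ?_) (h.trans ((Real.exp_le_exp.mpr hsum).trans Real.exp_one_lt_three.le))
  refine Finset.sum_congr rfl fun A _ => ?_
  congr 2
  have e : √N * (z * (fourier (char ℂ A) r - fourier (fun x => (F x : ℂ)) r)).re =
      (√N)⁻¹ * (N * (z * (fourier (char ℂ A) r - fourier (fun x => (F x : ℂ)) r)).re) := by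
    rw [← mul_assoc, inv_mul_eq_div, Real.div_sqrt]
  rw [e, re_mul_fourier_sub, Finset.mul_sum]
  exact Finset.sum_congr rfl fun x _ => by rw [ht]; ring

/-- A function with values in `[0, 1]` is approximated by a set, in all Fourier coefficients and,
from above, in the density of progressions. -/
theorem exists_finset_approx {F : ZMod N → ℝ} (h0 : ∀ x, 0 ≤ F x) (h1 : ∀ x, F x ≤ 1)
    (hN : 19 ≤ N) :
    ∃ A : Finset (ZMod N),
      (∀ r, ‖fourier (char ℂ A) r - fourier (fun x => (F x : ℂ)) r‖ ≤
        6 * (N : ℝ) ^ (-(1 / 2 : ℝ)) * Real.log N) ∧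
      fourAPDensity A ≤ progressionAvg F + 18 / N := by
  have hN' : (19 : ℝ) ≤ N := by exact_mod_cast hN
  have hNpos : (0 : ℝ) < N := by linarith
  set D : Finset (ZMod N) → ZMod N → ℂ :=
    fun A r => fourier (char ℂ A) r - fourier (fun x => (F x : ℂ)) r with hD
  -- The four directions 1, i, -1, -i turn one-sided bounds into bounds on |Re| and |Im|.
  set G : Finset (ZMod N) → ZMod N → ℕ → ℝ :=
    fun A r k => Real.exp (√N * (Complex.I ^ k * D A r).re) with hG
  -- One functional controls both requirements at once: degenerate progressions cost 6/N, and the 4N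
  -- moments, each at most 3 and scaled by N^(-2), cost 12/N.
  have hsum : ∑ A : Finset (ZMod N), setWeight F A *
      (fourAPDensity A + ((N : ℝ) ^ 2)⁻¹ * ∑ r, ∑ k ∈ Finset.range 4, G A r k) ≤
      progressionAvg F + 18 / N := by
    have hexp : ∑ A : Finset (ZMod N), setWeight F A *
        ∑ r, ∑ k ∈ Finset.range 4, G A r k ≤ N * 12 := by
      simp_rw [Finset.mul_sum]
      rw [Finset.sum_comm]
      refine (Finset.sum_le_card_nsmul _ _ 12 fun r _ => ?_).trans (by simp [ZMod.card])
      rw [Finset.sum_comm]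
      refine (Finset.sum_le_card_nsmul _ _ 3 fun k _ => ?_).trans (by norm_num)
      exact sum_setWeight_mul_exp_fourier_le h0 h1 r (by simp)
    have hap := sum_setWeight_mul_fourAPDensity_le h0 h1
    have hexp' := mul_le_mul_of_nonneg_left hexp (show (0 : ℝ) ≤ ((N : ℝ) ^ 2)⁻¹ by positivity)
    simp_rw [mul_add, Finset.sum_add_distrib, mul_left_comm (setWeight F _), ← Finset.mul_sum]
    have e : ((N : ℝ) ^ 2)⁻¹ * (N * 12) = 12 / N := by field_simp
    have e2 : (18 : ℝ) / N = 6 / N + 12 / N := by ring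
    rw [e] at hexp'
    linarith
  obtain ⟨A, hA⟩ := exists_le_of_sum_setWeight_mul_le h0 h1 hsum
  have hG0 : ∀ r k, 0 ≤ G A r k := fun r k => (Real.exp_pos _).le
  have hap0 : 0 ≤ fourAPDensity A := Finset.expect_nonneg fun x _ => Finset.expect_nonneg
    fun d _ => by rw [char_mul_eq_ite_subset]; split_ifs <;> norm_num
  have hS0 : 0 ≤ ∑ r, ∑ k ∈ Finset.range 4, G A r k :=
    Finset.sum_nonneg fun r _ => Finset.sum_nonneg fun k _ => hG0 r k
  have hF1 : progressionAvg F ≤ 1 := by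
    refine Finset.expect_le Finset.univ_nonempty fun x _ =>
      Finset.expect_le Finset.univ_nonempty fun d _ => ?_
    exact mul_le_one₀ (mul_le_one₀ (mul_le_one₀ (h1 _) (h0 _) (h1 _)) (h0 _) (h1 _)) (h0 _) (h1 _)
  have hbound : ∀ r, ∀ k ∈ Finset.range 4, (Complex.I ^ k * D A r).re ≤
      3 * (N : ℝ) ^ (-(1 / 2 : ℝ)) * Real.log N := by
    intro r k hk
    have hle : G A r k ≤ (N : ℝ) ^ 3 := by
      have a1 : G A r k ≤ ∑ r, ∑ k ∈ Finset.range 4, G A r k :=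
        (Finset.single_le_sum (f := fun k => G A r k) (fun k _ => hG0 r k) hk).trans
          (Finset.single_le_sum (f := fun r => ∑ k ∈ Finset.range 4, G A r k)
            (fun r _ => Finset.sum_nonneg fun k _ => hG0 r k) (Finset.mem_univ r))
      -- The chosen A gives at most 1 + 18/N ≤ 19 ≤ N.
      have a2 : ((N : ℝ) ^ 2)⁻¹ * ∑ r, ∑ k ∈ Finset.range 4, G A r k ≤ N := by
        have : (18 : ℝ) / N ≤ 18 := div_le_self (by norm_num) (by linarith)
        linarith
      rw [inv_mul_le_iff₀ (by positivity)] at a2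
      exact a1.trans (a2.trans (le_of_eq (by ring)))
    have hlog := (Real.le_log_iff_exp_le (by positivity)).mpr hle
    rw [Real.log_pow] at hlog
    have hs : 0 < √(N : ℝ) := Real.sqrt_pos.mpr hNpos
    rw [Real.rpow_neg hNpos.le, ← Real.sqrt_eq_rpow]
    have : (Complex.I ^ k * D A r).re ≤ (3 * Real.log N) / √N := by
      rw [le_div_iff₀ hs, mul_comm]; exact_mod_cast hlog
    exact this.trans (le_of_eq (by ring))
  refine ⟨A, fun r => ?_, ?_⟩
  · have b0 := hbound r 0 (by simp)
    have b1 := hbound r 1 (by simp)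
    have b2 := hbound r 2 (by simp)
    have b3 := hbound r 3 (by simp)
    simp only [pow_zero, one_mul, pow_one, Complex.I_sq, Complex.I_pow_three, neg_mul,
      Complex.neg_re, Complex.I_mul_re] at b0 b1 b2 b3
    refine (Complex.norm_le_abs_re_add_abs_im (D A r)).trans ?_
    have c1 : |(D A r).re| ≤ 3 * (N : ℝ) ^ (-(1 / 2 : ℝ)) * Real.log N :=
      abs_le.mpr ⟨by linarith, b0⟩
    have c2 : |(D A r).im| ≤ 3 * (N : ℝ) ^ (-(1 / 2 : ℝ)) * Real.log N :=
      abs_le.mpr ⟨by linarith, by linarith⟩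
    linarith
  · have : 0 ≤ ((N : ℝ) ^ 2)⁻¹ * ∑ r, ∑ k ∈ Finset.range 4, G A r k := by positivity
    linarith

/-! ### The quadratic profile -/

/-- The coefficients, times 16, of the exponentials making up `profile`. -/
def weight : Fin 9 → ℤ := ![8, 1, 1, -1, -1, 1, 1, 1, 1]

/-- The quadratic coefficients of the phases of `profile`. -/
def quadCoeff : Fin 9 → ℤ := ![0, 1, -1, 1, -1, 3, -3, 3, -3]

/-- The linear coefficients of the phases of `profile`. -/
def linCoeff : Fin 9 → ℤ := ![0, 0, 0, 1, -1, 1, -1, 2, -2]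

/-- The phase `e((a x² + b x)/N)` with the `i`-th pair of coefficients. -/
noncomputable def quadPhase (i : Fin 9) (x : ZMod N) : ℂ :=
  ZMod.stdAddChar ((quadCoeff i : ZMod N) * x ^ 2 + (linCoeff i : ZMod N) * x)

/-- A function with values in `[0, 1]`, average about `1/2`, small Fourier coefficients, and
`progressionAvg` less than `1/16`. -/
noncomputable def profile (x : ZMod N) : ℝ :=
  1 / 2 + 1 / 8 * ((ZMod.stdAddChar (x ^ 2) : ℂ).re - (ZMod.stdAddChar (x ^ 2 + x) : ℂ).re
    + (ZMod.stdAddChar (3 * x ^ 2 + x) : ℂ).re + (ZMod.stdAddChar (3 * x ^ 2 + 2 * x) : ℂ).re)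

theorem ofReal_profile (x : ZMod N) :
    (profile x : ℂ) = ∑ i, (weight i : ℂ) / 16 * quadPhase i x := by
  have hre : ∀ y : ZMod N, (((ZMod.stdAddChar y : ℂ).re : ℝ) : ℂ) =
      (ZMod.stdAddChar y + ZMod.stdAddChar (-y)) / 2 := fun y => by
    rw [AddChar.map_neg_eq_conj, Complex.re_eq_add_conj]
  have e1 : -(x ^ 2) = -1 * x ^ 2 := by ring
  have e2 : -(x ^ 2 + x) = -1 * x ^ 2 + -1 * x := by ring
  have e3 : -(3 * x ^ 2 + x) = -3 * x ^ 2 + -1 * x := by ring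
  have e4 : -(3 * x ^ 2 + 2 * x) = -3 * x ^ 2 + -2 * x := by ring
  rw [profile]
  push_cast
  rw [hre, hre, hre, hre, e1, e2, e3, e4]
  simp only [Fin.sum_univ_succ, weight, quadPhase, quadCoeff, linCoeff, Fin.sum_univ_zero]
  simp only [Matrix.cons_val_zero, Matrix.cons_val_succ]
  push_cast
  simp only [zero_mul, add_zero, one_mul, AddChar.map_zero_eq_one]
  ring

theorem abs_re_stdAddChar_le (y : ZMod N) : |(ZMod.stdAddChar y : ℂ).re| ≤ 1 :=
  (Complex.abs_re_le_norm _).trans (norm_stdAddChar y).le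

theorem profile_mem_Icc (x : ZMod N) : profile x ∈ Set.Icc (0 : ℝ) 1 := by
  have h1 := abs_le.mp (abs_re_stdAddChar_le (x ^ 2))
  have h2 := abs_le.mp (abs_re_stdAddChar_le (x ^ 2 + x))
  have h3 := abs_le.mp (abs_re_stdAddChar_le (3 * x ^ 2 + x))
  have h4 := abs_le.mp (abs_re_stdAddChar_le (3 * x ^ 2 + 2 * x))
  rw [profile]
  constructor <;> linarith [h1.1, h1.2, h2.1, h2.2, h3.1, h3.2, h4.1, h4.2]

theorem abs_quadCoeff_le (i : Fin 9) : |quadCoeff i| ≤ 3 := by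
  revert i; decide

theorem abs_linCoeff_le (i : Fin 9) : |linCoeff i| ≤ 2 := by
  revert i; decide

theorem quadCoeff_ne_zero {i : Fin 9} (hi : i ≠ 0) : quadCoeff i ≠ 0 := by
  revert i; decide

/-- The phase `φ_i(x) + φ_j(x+d) + φ_k(x+2d) + φ_l(x+3d)` vanishes identically. -/
def PhasesCancel (i j k l : Fin 9) : Prop :=
  quadCoeff i + quadCoeff j + quadCoeff k + quadCoeff l = 0 ∧
  2 * (quadCoeff j + 2 * quadCoeff k + 3 * quadCoeff l) = 0 ∧
  quadCoeff j + 4 * quadCoeff k + 9 * quadCoeff l = 0 ∧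
  linCoeff i + linCoeff j + linCoeff k + linCoeff l = 0 ∧
  linCoeff j + 2 * linCoeff k + 3 * linCoeff l = 0

instance (i j k l : Fin 9) : Decidable (PhasesCancel i j k l) := by
  unfold PhasesCancel; infer_instance

/-- Cancellation forces quadratic coefficients t(1, -3, 3, -1) with t = 0, 1, -1. The case t = 0
gives 8⁴ = 4096. For t = ±1 the linear conditions leave just t(1, -2, 1, 0) and t(0, -1, 2, -1),
each of weight -1, for a total of -4. -/
theorem sum_weight_phasesCancel :
    ∑ i, ∑ j, ∑ k, ∑ l, weight i * weight j * weight k * weight l *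
      (if PhasesCancel i j k l then 1 else 0) = 4092 := by
  decide +kernel

theorem sum_abs_weight : ∑ i, |weight i| = 16 := by
  decide

/-- The average of `φ_i(x) φ_j(x+d) φ_k(x+2d) φ_l(x+3d)`. -/
noncomputable def phaseCorrelation (N : ℕ) [NeZero N] (i j k l : Fin 9) : ℂ :=
  𝔼 x : ZMod N, 𝔼 d : ZMod N,
    quadPhase i x * quadPhase j (x + d) * quadPhase k (x + 2 * d) * quadPhase l (x + 3 * d)

theorem phaseCorrelation_eq (i j k l : Fin 9) :
    phaseCorrelation N i j k l = phaseAvg N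
      (quadCoeff i + quadCoeff j + quadCoeff k + quadCoeff l)
      (2 * (quadCoeff j + 2 * quadCoeff k + 3 * quadCoeff l))
      (quadCoeff j + 4 * quadCoeff k + 9 * quadCoeff l)
      (linCoeff i + linCoeff j + linCoeff k + linCoeff l)
      (linCoeff j + 2 * linCoeff k + 3 * linCoeff l) := by
  refine Finset.expect_congr rfl fun x _ => Finset.expect_congr rfl fun d _ => ?_
  simp only [quadPhase, ← AddChar.map_add_eq_mul]
  congr 1
  push_cast
  ring

theorem norm_phaseCorrelation_sub_le (hN : 42 < N) (i j k l : Fin 9) :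
    ‖phaseCorrelation N i j k l - if PhasesCancel i j k l then 1 else 0‖ ≤ √(84 / N) := by
  rw [phaseCorrelation_eq]
  split_ifs with h
  · rw [h.1, h.2.1, h.2.2.1, h.2.2.2.1, h.2.2.2.2]
    simp only [phaseAvg, Int.cast_zero, zero_mul, add_zero, AddChar.map_zero_eq_one,
      Fintype.expect_const, sub_self, norm_zero]
    exact Real.sqrt_nonneg _
  · have a := fun i => abs_le.mp (abs_quadCoeff_le i)
    have b := fun i => abs_le.mp (abs_linCoeff_le i)
    have ai := a i; have aj := a j; have ak := a k; have al := a l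
    have bi := b i; have bj := b j; have bk := b k; have bl := b l
    rw [sub_zero]
    -- The largest coefficient is that of d², at most (1 + 4 + 9) · 3 = 42.
    refine (norm_phaseAvg_le (K := 42) ?_ ?_ ?_ ?_ ?_ (by exact_mod_cast hN) h).trans
      (le_of_eq (by norm_num)) <;> rw [abs_le] <;> constructor <;> linarith

theorem progressionAvg_ofReal (F : ZMod N → ℝ) :
    ((progressionAvg F : ℝ) : ℂ) = progressionAvg (fun x => (F x : ℂ)) := by
  simp only [progressionAvg, Fintype.expect_eq_sum_div_card]
  push_cast
  rfl

theorem progressionAvg_sum (c : Fin 9 → ℂ) :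
    progressionAvg (fun x : ZMod N => ∑ i, c i * quadPhase i x) =
      ∑ i, ∑ j, ∑ k, ∑ l, c i * c j * c k * c l * phaseCorrelation N i j k l := by
  have h : ∀ x d : ZMod N,
      (∑ i, c i * quadPhase i x) * (∑ i, c i * quadPhase i (x + d)) *
        (∑ i, c i * quadPhase i (x + 2 * d)) * (∑ i, c i * quadPhase i (x + 3 * d)) =
      ∑ i, ∑ j, ∑ k, ∑ l, c i * c j * c k * c l * (quadPhase i x * quadPhase j (x + d) *
        quadPhase k (x + 2 * d) * quadPhase l (x + 3 * d)) := by
    intro x d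
    have e : ∀ i j k l : Fin 9, c i * c j * c k * c l * (quadPhase i x * quadPhase j (x + d) *
        quadPhase k (x + 2 * d) * quadPhase l (x + 3 * d)) =
        (c i * quadPhase i x) * (c j * quadPhase j (x + d)) * (c k * quadPhase k (x + 2 * d)) *
          (c l * quadPhase l (x + 3 * d)) := fun i j k l => by ring
    simp only [e, ← Finset.mul_sum, ← Finset.sum_mul]
  simp only [progressionAvg, h, Finset.expect_sum_comm, ← Finset.mul_expect, phaseCorrelation]

theorem abs_progressionAvg_profile_sub_le (hN : 42 < N) :
    |progressionAvg (profile : ZMod N → ℝ) - (1 / 16 - 1 / 16384)| ≤ √(84 / N) := by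
  have hmain : ((1 / 16 - 1 / 16384 : ℝ) : ℂ) = ∑ i, ∑ j, ∑ k, ∑ l,
      (weight i : ℂ) / 16 * (weight j / 16) * (weight k / 16) * (weight l / 16) *
        (if PhasesCancel i j k l then 1 else 0) := by
    have h := congrArg (fun n : ℤ => (n : ℂ) / 65536) sum_weight_phasesCancel
    push_cast at h
    simp_rw [Finset.sum_div] at h
    push_cast
    calc _ = (4092 : ℂ) / 65536 := by norm_num
      _ = _ := by
        rw [← h]
        refine Finset.sum_congr rfl fun i _ => Finset.sum_congr rfl fun j _ =>
          Finset.sum_congr rfl fun k _ => Finset.sum_congr rfl fun l _ => ?_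
        ring
  have habs : ∑ i, |(weight i : ℝ) / 16| = 1 := by
    have h := congrArg (fun n : ℤ => (n : ℝ) / 16) sum_abs_weight
    push_cast at h
    rw [Finset.sum_div] at h
    simp_rw [abs_div]
    norm_num at h ⊢
    exact h
  rw [← Real.norm_eq_abs, ← Complex.norm_real]
  rw [Complex.ofReal_sub, progressionAvg_ofReal, hmain]
  simp_rw [ofReal_profile]
  rw [progressionAvg_sum]
  simp_rw [← Finset.sum_sub_distrib, ← mul_sub]
  calc _ ≤ ∑ i, ∑ j, ∑ k, ∑ l, |(weight i : ℝ) / 16| * |(weight j : ℝ) / 16| *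
        |(weight k : ℝ) / 16| * |(weight l : ℝ) / 16| * √(84 / N) := by
        refine norm_sum_le_of_le _ fun i _ => norm_sum_le_of_le _ fun j _ =>
          norm_sum_le_of_le _ fun k _ => norm_sum_le_of_le _ fun l _ => ?_
        rw [norm_mul]
        refine mul_le_mul (le_of_eq ?_) (norm_phaseCorrelation_sub_le hN i j k l)
          (norm_nonneg _) (by positivity)
        simp only [norm_mul, norm_div, Complex.norm_intCast, abs_div]
        norm_num
    _ = √(84 / N) := by
        simp only [← Finset.sum_mul, ← Finset.mul_sum, habs, one_mul]

/-- The constant phase gives the value 1/2 at r = 0; the others keep a nonzero quadratic coefficient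
after the shift by r, and their weights total 1/2. -/
theorem norm_fourier_profile_sub_le (r : ZMod N) :
    ‖fourier (fun x => ((profile x : ℝ) : ℂ)) r - if r = 0 then 1 / 2 else 0‖ ≤ √(6 / N) := by
  have hN : (N : ℂ) ≠ 0 := by exact_mod_cast NeZero.ne N
  have hexp : fourier (fun x => ((profile x : ℝ) : ℂ)) r =
      ∑ i, (weight i : ℂ) / 16 * 𝔼 x : ZMod N, (ZMod.stdAddChar
        ((quadCoeff i : ZMod N) * x ^ 2 + ((linCoeff i : ZMod N) - r) * x) : ℂ) := by
    simp_rw [fourier, ofReal_profile, Finset.mul_expect, ← Finset.expect_sum_comm, Finset.sum_mul]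
    refine Finset.expect_congr rfl fun x _ => Finset.sum_congr rfl fun i _ => ?_
    rw [quadPhase, mul_assoc, ← AddChar.map_add_eq_mul]
    congr 2
    ring
  have hzero : 𝔼 x : ZMod N, (ZMod.stdAddChar
      ((quadCoeff 0 : ZMod N) * x ^ 2 + ((linCoeff 0 : ZMod N) - r) * x) : ℂ) =
      if r = 0 then 1 else 0 := by
    have : ∀ x : ZMod N, (quadCoeff 0 : ZMod N) * x ^ 2 + ((linCoeff 0 : ZMod N) - r) * x =
        -r * x := fun x => by simp [quadCoeff, linCoeff]
    simp_rw [this]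
    rw [Fintype.expect_eq_sum_div_card, sum_stdAddChar_mul, ZMod.card]
    simp only [neg_eq_zero]
    split_ifs <;> simp [hN]
  have hw : ∑ i : Fin 8, |(weight i.succ : ℝ) / 16| ≤ 1 := by
    have h : ∑ i : Fin 8, |weight i.succ| = 8 := by decide
    have h := congrArg (fun n : ℤ => (n : ℝ) / 16) h
    push_cast at h
    rw [Finset.sum_div] at h
    simp_rw [abs_div]
    norm_num at h ⊢
    rw [h]; norm_num
  rw [hexp, Fin.sum_univ_succ, hzero]
  have h0 : (weight 0 : ℂ) / 16 * (if r = 0 then 1 else 0) = if r = 0 then 1 / 2 else 0 := by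
    simp only [weight, Matrix.cons_val_zero]
    split_ifs <;> norm_num
  rw [h0, add_sub_cancel_left]
  calc _ ≤ ∑ i : Fin 8, |(weight i.succ : ℝ) / 16| * √(6 / N) := by
        refine norm_sum_le_of_le _ fun i _ => ?_
        rw [norm_mul]
        refine mul_le_mul (le_of_eq ?_) ?_ (norm_nonneg _) (abs_nonneg _)
        · simp [abs_div]
        · refine (norm_expect_quadratic_le (quadCoeff_ne_zero (Fin.succ_ne_zero i)) _).trans ?_
          have : |(quadCoeff i.succ : ℝ)| ≤ 3 := by exact_mod_cast abs_quadCoeff_le i.succ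
          apply Real.sqrt_le_sqrt
          gcongr
          linarith
    _ ≤ √(6 / N) := by
        rw [← Finset.sum_mul]
        exact mul_le_of_le_one_left (Real.sqrt_nonneg _) hw

end UniformSet

/-! ### Conclusion for large N -/

namespace UniformSet

theorem tendsto_rpow_neg_half_mul_log (C : ℝ) :
    Tendsto (fun N : ℕ => C * (N : ℝ) ^ (-(1 / 2 : ℝ)) * Real.log N) atTop (𝓝 0) := by
  have h := (isLittleO_log_rpow_atTop (show (0 : ℝ) < 1 / 2 by norm_num)).tendsto_div_nhds_zero
  have h2 := (h.comp tendsto_natCast_atTop_atTop).const_mul C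
  rw [mul_zero] at h2
  refine h2.congr fun N => ?_
  simp only [Function.comp_apply]
  rw [Real.rpow_neg (Nat.cast_nonneg N)]
  ring

/-- The errors may use up half of the gain 1/16384. -/
theorem eventually_error_le :
    ∀ᶠ N : ℕ in atTop, √(84 / (N : ℝ)) + 18 / N ≤ 1 / 32768 := by
  have h1 : Tendsto (fun N : ℕ => √(84 / (N : ℝ)) + 18 / N) atTop (𝓝 (√0 + 0)) :=
    ((Real.continuous_sqrt.tendsto 0).comp (tendsto_const_div_atTop_nhds_zero_nat 84)).add
      (tendsto_const_div_atTop_nhds_zero_nat 18)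
  rw [Real.sqrt_zero, add_zero] at h1
  exact h1.eventually_le_const (by norm_num)

theorem fourier_char_zero {N : ℕ} [NeZero N] (A : Finset (ZMod N)) :
    fourier (char ℂ A) 0 = (density A : ℂ) := by
  simp [fourier, density, char, Fintype.expect_eq_sum_div_card, ZMod.card]

theorem exists_uniform_few_progressions :
    ∃ N₀ : ℕ, ∀ (N : ℕ) [NeZero N], N₀ ≤ N → ∃ A : Finset (ZMod N),
      IsUniform (9 * (N : ℝ) ^ (-(1 / 2 : ℝ)) * Real.log N) A ∧
      |density A - 1 / 2| ≤ 9 * (N : ℝ) ^ (-(1 / 2 : ℝ)) * Real.log N ∧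
      fourAPDensity A ≤ 1 / 16 - 1 / 32768 := by
  obtain ⟨N₁, hN₁⟩ := eventually_atTop.mp eventually_error_le
  refine ⟨max N₁ 43, fun N _ hN => ?_⟩
  have h43 : 42 < N := lt_of_lt_of_le (by norm_num) ((le_max_right N₁ 43).trans hN)
  have herr := hN₁ N ((le_max_left _ _).trans hN)
  have hNpos : (0 : ℝ) < N := by exact_mod_cast (by omega : 0 < N)
  obtain ⟨A, hA, hap⟩ := exists_finset_approx (F := (profile : ZMod N → ℝ))
    (fun x => (profile_mem_Icc x).1) (fun x => (profile_mem_Icc x).2) (by omega)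
  have hlog : 1 ≤ Real.log N := by
    rw [Real.le_log_iff_exp_le hNpos]
    have : (42 : ℝ) < N := by exact_mod_cast h43
    linarith [Real.exp_one_lt_three]
  -- The constant 9 is 3 from the profile plus 6 from the random set.
  have hsqrt : √(6 / (N : ℝ)) ≤ 3 * (N : ℝ) ^ (-(1 / 2 : ℝ)) * Real.log N := by
    rw [Real.rpow_neg hNpos.le, ← Real.sqrt_eq_rpow, Real.sqrt_div (by norm_num), div_eq_mul_inv]
    have h6 : √(6 : ℝ) ≤ 3 := Real.sqrt_le_iff.mpr (by norm_num)
    have hs : 0 ≤ (√(N : ℝ))⁻¹ := by positivity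
    nlinarith [mul_le_mul_of_nonneg_right h6 hs, mul_nonneg hs (sub_nonneg.mpr hlog)]
  have hfour : ∀ r, ‖fourier (char ℂ A) r - if r = 0 then 1 / 2 else 0‖ ≤
      9 * (N : ℝ) ^ (-(1 / 2 : ℝ)) * Real.log N := fun r => by
    have h := norm_sub_le_norm_sub_add_norm_sub (fourier (char ℂ A) r)
      (fourier (fun x => ((profile x : ℝ) : ℂ)) r) (if r = 0 then 1 / 2 else 0)
    linarith [hA r, norm_fourier_profile_sub_le r]
  refine ⟨A, fun r hr => ?_, ?_, ?_⟩
  · simpa [hr] using hfour r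
  · have h := hfour 0
    rw [if_pos rfl, fourier_char_zero] at h
    rw [← Real.norm_eq_abs, ← Complex.norm_real]
    push_cast
    exact h
  · have := (abs_le.mp (abs_progressionAvg_profile_sub_le (N := N) h43)).2
    linarith

theorem fourAPCount_eq {N : ℕ} [NeZero N] (A : Finset (ZMod N)) :
    (fourAPCount A : ℝ) = fourAPDensity A * (N : ℝ) ^ 2 := by
  have hN : (N : ℝ) ≠ 0 := by exact_mod_cast NeZero.ne N
  simp only [fourAPDensity, Fintype.expect_eq_sum_div_card, ZMod.card, ← Finset.sum_div]
  rw [div_div, ← sq, div_mul_cancel₀ _ (pow_ne_zero 2 hN), ← Fintype.sum_prod_type', fourAPCount,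
    Finset.card_filter, Nat.cast_sum]
  refine Finset.sum_congr rfl fun p _ => ?_
  rw [char_mul_eq_ite_subset]
  simp only [Finset.insert_subset_iff, Finset.singleton_subset_iff]
  split_ifs <;> simp

theorem not_fourAPConjecture {c C : ℝ} (hc : 0 < c) {ε : ℕ → ℝ} (hε : Tendsto ε atTop (𝓝 0))
    {N₀ : ℕ} (h : ∀ (N : ℕ) [NeZero N], N₀ ≤ N → ∃ A : Finset (ZMod N),
      IsUniform (C * (N : ℝ) ^ (-(1 / 2 : ℝ)) * Real.log N) A ∧
      |density A - 1 / 2| ≤ ε N ∧ fourAPDensity A ≤ 1 / 16 - c) :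
    ¬ FourAPConjecture := by
  rintro ⟨η, hη, hconj⟩
  -- Half of c is allotted to η(γ), the other half to the deviation of the fourth power of the
  -- density from 1/16.
  obtain ⟨γ, hγη, hγ⟩ :=
    ((hη.eventually_lt_const (half_pos hc)).and self_mem_nhdsWithin).exists
  obtain ⟨N₁, hN₁⟩ := hconj γ hγ
  have hpow : Tendsto (fun N => (1 / 2 - ε N) ^ 4) atTop (𝓝 ((1 / 2 - 0) ^ 4)) :=
    (tendsto_const_nhds.sub hε).pow 4
  have hlt : (1 / 16 - c / 2 : ℝ) < (1 / 2 - 0) ^ 4 := by norm_num; linarith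
  obtain ⟨N, ⟨⟨hNpow, hNε⟩, hNγ⟩, hN0, hN1, hN2⟩ :=
    ((((hpow.eventually_const_lt hlt).and
      (hε.eventually_lt_const (show (0 : ℝ) < 1 / 2 by norm_num))).and
      ((tendsto_rpow_neg_half_mul_log C).eventually_lt_const hγ)).and
      ((eventually_ge_atTop N₀).and ((eventually_ge_atTop N₁).and (eventually_gt_atTop 0)))).exists
  have : NeZero N := ⟨hN2.ne'⟩
  obtain ⟨A, hAu, hAd, hAp⟩ := h N hN0
  have hcount := hN₁ N hN1 A fun r hr => (hAu r hr).trans hNγ.le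
  have hNsq : (0 : ℝ) < (N : ℝ) ^ 2 := by positivity
  rw [fourAPCount_eq] at hcount
  have hle := le_of_mul_le_mul_right hcount hNsq
  have hdens : (1 / 2 - ε N) ^ 4 ≤ density A ^ 4 :=
    pow_le_pow_left₀ (by linarith) (by linarith [(abs_le.mp hAd).1]) 4
  linarith

end UniformSet

theorem theorem6 :
    (∃ c : ℝ, 0 < c ∧ ∃ C : ℝ, ∃ ε : ℕ → ℝ, Tendsto ε atTop (𝓝 0) ∧
      ∃ N₀ : ℕ, ∀ (N : ℕ) [NeZero N], N₀ ≤ N →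
        ∃ A : Finset (ZMod N),
          UniformSet.IsUniform (C * (N : ℝ) ^ (-(1 / 2 : ℝ)) * Real.log N) A ∧
          |UniformSet.density A - 1 / 2| ≤ ε N ∧
          UniformSet.fourAPDensity A ≤ 1 / 16 - c) ∧
    ¬ UniformSet.FourAPConjecture := by
  obtain ⟨N₀, h⟩ := UniformSet.exists_uniform_few_progressions
  have hε := UniformSet.tendsto_rpow_neg_half_mul_log 9
  exact ⟨⟨1 / 32768, by norm_num, 9, _, hε, N₀, h⟩,
    UniformSet.not_fourAPConjecture (by norm_num) hε h⟩
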